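/- Consider $n\ge 1$ qudits of local dimension $q\ge 1$, with total dimension $d=q^n$, arranged on a line (an open chain or a ring). Let $\mathsf G\subset U(q^2)$ be a finite gate set containing the identity. For $r\in\mathbb N$ let $\mathsf G_r\subset U(d)$ be the set of unitaries generated by circuits of at most $r$ gates, each of which is an element of $\mathsf G$ applied to a pair of neighbouring qudits $(i,i+1)$ (on the ring also $(n,1)$ if $n\ge2$); in particular $\mathsf G_0=\{\mathbb I\}$. For $A\in U(d)$ write $\mathcal A(\rho)=A\rho A^\dagger$. For a linear map $\Phi$ on $D\times D$ matrices let $\|\Phi\|_\diamond=\sup\{\|(\Phi\otimes\mathcal I_D)(X)\|_1:\|X\|_1\le 1\}$ be its diamond norm, where $\|\cdot\|_1$ is the trace norm. For $\delta\in[0,1)$ the weak $\delta$-complexity $\mathcal C'_\delta(U)$ of $U\in U(d)$ is the least $r\in\mathbb N$ for which some $V\in\mathsf G_r$ satisfies $\tfrac12\|\mathcal U-\mathcal V\|_\diamond\le\delta$ (and $+\infty$ if there is no such $r$). Let $\mathcal E=\{p_i,U_i\}_{i=1}^N$ be a finite ensemble of unitaries $U_i\in U(d)$ with probabilities $p_i\ge0$,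 $\sum_i p_i=1$. For $k\in\mathbb N$ and $\epsilon\ge0$ it is an $\epsilon$-approximate unitary $k$-design if $$\big\|\mathcal T^{(k)}_{\mathcal E}-\mathcal T^{(k)}_U\big\|_\diamond\le\frac{k!}{d^{2k}}\,\epsilon,\qquad \mathcal T^{(k)}_{\mathcal E}(X)=\sum_i p_i\,U_i^{\otimes k}X(U_i^\dagger)^{\otimes k},\qquad \mathcal T^{(k)}_U(X)=\int_{U(d)}U^{\otimes k}X(U^\dagger)^{\otimes k}\,dU,$$ where $dU$ is the normalized Haar measure on $U(d)$. **Theorem.** Let $\mathcal E$ be an $\epsilon$-approximate unitary $k$-design, $\delta\in[0,1)$ and $r\in\mathbb N$. Then the number of distinct unitaries $U$ that occur in $\mathcal E$ with positive probability and satisfy $\mathcal C'_\delta(U)>r$ is at least $$\frac{d^{2k}}{k!}\,\frac{1}{1+\epsilon}-\frac{n^r\,|\mathsf G|^r}{(1-\delta^2)^k}.$$ -/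

import Mathlib

open MeasureTheory
open scoped ENNReal

noncomputable section

namespace QComplexity

/-! ### Norms on matrices and on linear maps between matrix spaces -/

/-- The trace norm `‖X‖₁`, i.e. the sum of the singular values of `X` (the square roots of the
eigenvalues of `Xᴴ * X`). -/
def traceNorm {ι : Type*} [Fintype ι] [DecidableEq ι] (X : Matrix ι ι ℂ) : ℝ :=
  ∑ i, √((Matrix.isHermitian_conjTranspose_mul_self X).eigenvalues i)

/-- The map `Φ ⊗ id` on operators on `ℂ^ι ⊗ ℂ^σ`, for a linear map `Φ` on operators on `ℂ^ι`:
the `(s, t)`-block of the image of `X` is the image under `Φ` of the `(s, t)`-block of `X`. -/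
def ampliate {ι : Type*} (σ : Type*) (Φ : Matrix ι ι ℂ →ₗ[ℂ] Matrix ι ι ℂ)
    (X : Matrix (ι × σ) (ι × σ) ℂ) : Matrix (ι × σ) (ι × σ) ℂ :=
  Matrix.of fun a b => Φ (Matrix.of fun i j => X (i, a.2) (j, b.2)) a.1 b.1

/-- The diamond norm `‖Φ‖_⋄ = sup {‖(Φ ⊗ id)(X)‖₁ : ‖X‖₁ ≤ 1}`, the auxiliary system having the
dimension of the input system. As a supremum in `[0, ∞]` it has no junk values. -/
def diamondNorm {ι : Type*} [Fintype ι] [DecidableEq ι]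
    (Φ : Matrix ι ι ℂ →ₗ[ℂ] Matrix ι ι ℂ) : ℝ≥0∞ :=
  ⨆ (X : Matrix (ι × ι) (ι × ι) ℂ) (_ : traceNorm X ≤ 1),
    ENNReal.ofReal (traceNorm (ampliate ι Φ X))

/-- Conjugation `X ↦ A X Aᴴ`; for unitary `A` this is the unitary channel of `A`. -/
def conjChannel {ι : Type*} [Fintype ι] (A : Matrix ι ι ℂ) :
    Matrix ι ι ℂ →ₗ[ℂ] Matrix ι ι ℂ where
  toFun X := A * X * A.conjTranspose
  map_add' X Y := by rw [Matrix.mul_add, Matrix.add_mul]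
  map_smul' c X := by rw [Matrix.mul_smul, Matrix.smul_mul, RingHom.id_apply]

/-! ### Haar measure on the unitary group -/

instance unitaryMeasurableSpace {ι : Type*} [Fintype ι] [DecidableEq ι] :
    MeasurableSpace (Matrix.unitaryGroup ι ℂ) := borel _

instance unitaryBorelSpace {ι : Type*} [Fintype ι] [DecidableEq ι] :
    BorelSpace (Matrix.unitaryGroup ι ℂ) := ⟨rfl⟩

instance unitaryCompactSpace {ι : Type*} [Fintype ι] [DecidableEq ι] :
    CompactSpace (Matrix.unitaryGroup ι ℂ) := by
  have hcl : IsClosed ((Matrix.unitaryGroup ι ℂ : Submonoid (Matrix ι ι ℂ)) :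
      Set (Matrix ι ι ℂ)) := isClosed_unitary
  have hK : IsCompact (Set.univ.pi fun _ : ι => Set.univ.pi fun _ : ι =>
      Metric.closedBall (0 : ℂ) 1) :=
    isCompact_univ_pi fun _ => isCompact_univ_pi fun _ => isCompact_closedBall _ _
  have hsub : ((Matrix.unitaryGroup ι ℂ : Submonoid (Matrix ι ι ℂ)) : Set (Matrix ι ι ℂ)) ⊆
      (Set.univ.pi fun _ : ι => Set.univ.pi fun _ : ι => Metric.closedBall (0 : ℂ) 1) := by
    intro U hU i _ j _
    rw [mem_closedBall_zero_iff]
    exact entry_norm_bound_of_unitary hU i j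
  exact isCompact_iff_compactSpace.mp (hK.of_isClosed_subset hcl hsub)

/-- The normalized Haar measure on the unitary group. -/
def haarUnitary (ι : Type*) [Fintype ι] [DecidableEq ι] :
    Measure (Matrix.unitaryGroup ι ℂ) :=
  Measure.haarMeasure ⊤

/-! ### Ensembles, twirls and approximate designs -/

/-- The matrix of the tensor power `A^{⊗k}` on `(ℂ^ι)^{⊗k}`, in the product basis. -/
def tensorPow {ι : Type*} (k : ℕ) (A : Matrix ι ι ℂ) : Matrix (Fin k → ι) (Fin k → ι) ℂ :=
  Matrix.of fun a b => ∏ l, A (a l) (b l)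

/-- A finite weighted ensemble of unitaries: `unitary i` occurs with probability `weight i`. -/
structure UnitaryEnsemble (ι : Type*) [Fintype ι] [DecidableEq ι] (N : ℕ) where
  weight : Fin N → ℝ
  unitary : Fin N → Matrix.unitaryGroup ι ℂ
  weight_nonneg : ∀ i, 0 ≤ weight i
  weight_sum : ∑ i, weight i = 1

/-- The `k`-fold twirl `X ↦ ∑ i, p_i U_i^{⊗k} X (U_i^{⊗k})ᴴ` of an ensemble. -/
def UnitaryEnsemble.twirl {ι : Type*} [Fintype ι] [DecidableEq ι] {N : ℕ}
    (E : UnitaryEnsemble ι N) (k : ℕ) :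
    Matrix (Fin k → ι) (Fin k → ι) ℂ →ₗ[ℂ] Matrix (Fin k → ι) (Fin k → ι) ℂ :=
  ∑ i, (E.weight i : ℂ) • conjChannel (tensorPow k (E.unitary i : Matrix ι ι ℂ))

theorem integrable_conj_entry {ι : Type*} [Fintype ι] [DecidableEq ι] (k : ℕ)
    (X : Matrix (Fin k → ι) (Fin k → ι) ℂ) (a b : Fin k → ι) :
    Integrable (fun U : Matrix.unitaryGroup ι ℂ =>
      conjChannel (tensorPow k (U : Matrix ι ι ℂ)) X a b) (haarUnitary ι) := by
  have hpow : Continuous fun U : Matrix.unitaryGroup ι ℂ =>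
      tensorPow k (U : Matrix ι ι ℂ) :=
    continuous_matrix fun c d => continuous_finsetProd Finset.univ fun l _ =>
      Continuous.matrix_elem (continuous_subtype_val (p := fun A : Matrix ι ι ℂ =>
        A ∈ Matrix.unitaryGroup ι ℂ)) (c l) (d l)
  have hcont : Continuous fun U : Matrix.unitaryGroup ι ℂ =>
      conjChannel (tensorPow k (U : Matrix ι ι ℂ)) X a b :=
    ((hpow.matrix_mul continuous_const).matrix_mul hpow.matrix_conjTranspose).matrix_elem a b
  have : IsFiniteMeasureOnCompacts (haarUnitary ι) := by
    unfold haarUnitary; infer_instance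
  exact hcont.integrable_of_hasCompactSupport
    (HasCompactSupport.of_compactSpace _)

/-- The `k`-fold twirl `X ↦ ∫ U^{⊗k} X (U^{⊗k})ᴴ dU` over the full unitary group; the integral
is taken entrywise. -/
def haarTwirl (ι : Type*) [Fintype ι] [DecidableEq ι] (k : ℕ) :
    Matrix (Fin k → ι) (Fin k → ι) ℂ →ₗ[ℂ] Matrix (Fin k → ι) (Fin k → ι) ℂ where
  toFun X := Matrix.of fun a b =>
    ∫ U : Matrix.unitaryGroup ι ℂ,
      conjChannel (tensorPow k (U : Matrix ι ι ℂ)) X a b ∂(haarUnitary ι)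
  map_add' X Y := by
    ext a b
    simp only [Matrix.of_apply, Matrix.add_apply, map_add]
    exact integral_add (integrable_conj_entry k X a b) (integrable_conj_entry k Y a b)
  map_smul' c X := by
    ext a b
    simp only [Matrix.of_apply, Matrix.smul_apply, map_smul, RingHom.id_apply]
    exact integral_smul c _

/-- `E` is an `ε`-approximate unitary `k`-design:
`‖T_E^{(k)} - T_U^{(k)}‖_⋄ ≤ (k! / d^{2k}) ε`, where `d` is the dimension. -/
def IsApproxDesign {ι : Type*} [Fintype ι] [DecidableEq ι] {N : ℕ}
    (E : UnitaryEnsemble ι N) (k : ℕ) (ε : ℝ) : Prop :=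
  diamondNorm (E.twirl k - haarTwirl ι k) ≤
    ENNReal.ofReal ((k.factorial : ℝ) / (Fintype.card ι : ℝ) ^ (2 * k) * ε)

/-! ### Circuits on `n` qudits of local dimension `q`

The computational basis of `(ℂ^q)^{⊗n}` is indexed by `Fin n → Fin q`. -/

/-- The matrix of the two-qudit gate `g` applied to the qudits `i` and `j` (in this order), acting
as the identity on all other qudits. -/
def gateMatrix {n q : ℕ} (i j : Fin n) (g : Matrix (Fin q × Fin q) (Fin q × Fin q) ℂ) :
    Matrix (Fin n → Fin q) (Fin n → Fin q) ℂ :=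
  Matrix.of fun x y =>
    if ∀ l, l ≠ i → l ≠ j → x l = y l then g (x i, x j) (y i, y j) else 0

theorem gateMatrix_mul {n q : ℕ} {i j : Fin n} (hij : i ≠ j)
    (g h : Matrix (Fin q × Fin q) (Fin q × Fin q) ℂ) :
    gateMatrix i j g * gateMatrix i j h = gateMatrix i j (g * h) := by
  ext x y
  simp only [gateMatrix, Matrix.mul_apply, Matrix.of_apply]
  by_cases hxy : ∀ l, l ≠ i → l ≠ j → x l = y l
  · rw [if_pos hxy]
    symm
    refine Finset.sum_of_injOn
      (fun p : Fin q × Fin q => fun l => if l = i then p.1 else if l = j then p.2 else x l)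
      ?_ (fun _ _ => Finset.mem_coe.mpr (Finset.mem_univ _)) ?_ ?_
    · intro p _ p' _ hpp
      have h1 := congrFun hpp i
      have h2 := congrFun hpp j
      simp only [if_true, if_neg hij.symm] at h1 h2
      exact Prod.ext h1 h2
    · intro z _ hz
      rw [if_neg, zero_mul]
      intro hxz
      apply hz
      refine ⟨(z i, z j), Finset.mem_coe.mpr (Finset.mem_univ _), ?_⟩
      funext l
      by_cases hli : l = i
      · simp [hli]
      · by_cases hlj : l = j
        · simp [hlj, hij.symm]
        · simp [hli, hlj, hxz l hli hlj]
    · intro p _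
      rw [if_pos, if_pos]
      · simp [hij.symm]
      · intro l hli hlj
        simp [hli, hlj, hxy l hli hlj]
      · intro l hli hlj
        simp [hli, hlj]
  · rw [if_neg hxy]
    refine Finset.sum_eq_zero fun z _ => ?_
    by_cases hxz : ∀ l, l ≠ i → l ≠ j → x l = z l
    · rw [if_neg (c := ∀ l, l ≠ i → l ≠ j → z l = y l), mul_zero]
      exact fun hzy => hxy fun l hli hlj => (hxz l hli hlj).trans (hzy l hli hlj)
    · rw [if_neg hxz, zero_mul]

theorem gateMatrix_conjTranspose {n q : ℕ} (i j : Fin n)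
    (g : Matrix (Fin q × Fin q) (Fin q × Fin q) ℂ) :
    (gateMatrix i j g).conjTranspose = gateMatrix i j g.conjTranspose := by
  ext x y
  simp only [gateMatrix, Matrix.conjTranspose_apply, Matrix.of_apply, apply_ite star, star_zero]
  exact if_congr ⟨fun h l hi hj => (h l hi hj).symm, fun h l hi hj => (h l hi hj).symm⟩ rfl rfl

theorem gateMatrix_one {n q : ℕ} (i j : Fin n) :
    gateMatrix i j (1 : Matrix (Fin q × Fin q) (Fin q × Fin q) ℂ) = 1 := by
  ext x y
  simp only [gateMatrix, Matrix.of_apply, Matrix.one_apply, Prod.mk.injEq]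
  by_cases hxy : x = y
  · subst hxy
    simp
  · rw [if_neg hxy]
    by_cases h : ∀ l, l ≠ i → l ≠ j → x l = y l
    · rw [if_pos h, if_neg]
      rintro ⟨hi, hj⟩
      apply hxy
      funext l
      by_cases hli : l = i
      · rw [hli, hi]
      · by_cases hlj : l = j
        · rw [hlj, hj]
        · exact h l hli hlj
    · rw [if_neg h]

/-- The two-qudit gate `g` applied to two distinct qudits `i` and `j`, as a unitary on `n`
qudits. -/
def gate {n q : ℕ} (i j : Fin n) (hij : i ≠ j) (g : Matrix.unitaryGroup (Fin q × Fin q) ℂ) :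
    Matrix.unitaryGroup (Fin n → Fin q) ℂ :=
  ⟨gateMatrix i j (g : Matrix (Fin q × Fin q) (Fin q × Fin q) ℂ), by
    rw [Matrix.mem_unitaryGroup_iff, Matrix.star_eq_conjTranspose, gateMatrix_conjTranspose,
      gateMatrix_mul hij, ← Matrix.star_eq_conjTranspose,
      Matrix.mem_unitaryGroup_iff.mp g.2, gateMatrix_one]⟩

/-- The ordered pair `(i, j)` consists of neighbouring qudits: `j` follows `i` on a chain with open
ends (`periodic = false`) or on a ring (`periodic = true`, where the last qudit is followed by the
first one). -/
def IsNeighbourPair {n : ℕ} (periodic : Bool) (i j : Fin n) : Prop :=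
  (i : ℕ) + 1 = j ∨ (periodic = true ∧ (i : ℕ) + 1 = n ∧ (j : ℕ) = 0)

/-- The set of unitaries that arise by applying one gate of `G` to a pair of neighbouring
qudits. -/
def localGates {n q : ℕ} (periodic : Bool)
    (G : Finset (Matrix.unitaryGroup (Fin q × Fin q) ℂ)) :
    Set (Matrix.unitaryGroup (Fin n → Fin q) ℂ) :=
  {W | ∃ g ∈ G, ∃ (i j : Fin n) (hij : i ≠ j), IsNeighbourPair periodic i j ∧ W = gate i j hij g}

/-- `G_r`: the unitaries on `n` qudits generated by `G`-local circuits of size at most `r`. -/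
def circuits {n q : ℕ} (periodic : Bool)
    (G : Finset (Matrix.unitaryGroup (Fin q × Fin q) ℂ)) (r : ℕ) :
    Set (Matrix.unitaryGroup (Fin n → Fin q) ℂ) :=
  {V | ∃ L : List (Matrix.unitaryGroup (Fin n → Fin q) ℂ),
    L.length ≤ r ∧ (∀ W ∈ L, W ∈ localGates periodic G) ∧ V = L.prod}

/-- Some circuit of size at most `r` approximates `U` up to `δ` in half the diamond distance. -/
def IsApproxBySize {n q : ℕ} (periodic : Bool)
    (G : Finset (Matrix.unitaryGroup (Fin q × Fin q) ℂ)) (δ : ℝ)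
    (U : Matrix.unitaryGroup (Fin n → Fin q) ℂ) (r : ℕ) : Prop :=
  ∃ V : Matrix.unitaryGroup (Fin n → Fin q) ℂ, V ∈ circuits periodic G r ∧
    diamondNorm (conjChannel (U : Matrix (Fin n → Fin q) (Fin n → Fin q) ℂ) -
      conjChannel (V : Matrix (Fin n → Fin q) (Fin n → Fin q) ℂ)) / 2 ≤ ENNReal.ofReal δ

/-- The weak `δ`-unitary complexity `C'_δ(U)`: the least size of a circuit that approximates `U` up
to `δ` in half the diamond distance (`⊤` if there is none). -/
def weakUnitaryComplexity {n q : ℕ} (periodic : Bool)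
    (G : Finset (Matrix.unitaryGroup (Fin q × Fin q) ℂ)) (δ : ℝ)
    (U : Matrix.unitaryGroup (Fin n → Fin q) ℂ) : ℕ∞ :=
  ⨅ (r : ℕ) (_ : IsApproxBySize periodic G δ U r), (r : ℕ∞)

/-- `C'_δ(U) ≤ r` holds iff a circuit of size at most `r` approximates `U`. -/
theorem weakUnitaryComplexity_le_iff {n q : ℕ} (periodic : Bool)
    (G : Finset (Matrix.unitaryGroup (Fin q × Fin q) ℂ)) (δ : ℝ)
    (U : Matrix.unitaryGroup (Fin n → Fin q) ℂ) (r : ℕ) :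
    weakUnitaryComplexity periodic G δ U ≤ (r : ℕ∞) ↔ IsApproxBySize periodic G δ U r := by
  constructor
  · intro h
    have h' : weakUnitaryComplexity periodic G δ U < ((r + 1 : ℕ) : ℕ∞) :=
      lt_of_le_of_lt h (by exact_mod_cast Nat.lt_succ_self r)
    simp only [weakUnitaryComplexity, iInf_lt_iff] at h'
    obtain ⟨s, ⟨V, ⟨L, hL, hLG, hV⟩, hd⟩, hs⟩ := h'
    have hs' : s < r + 1 := by exact_mod_cast hs
    exact ⟨V, ⟨L, by omega, hLG, hV⟩, hd⟩
  · intro h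
    exact iInf₂_le (f := fun (r : ℕ) (_ : IsApproxBySize periodic G δ U r) => (r : ℕ∞)) r h

end QComplexity

end

/-! Write `d` for the dimension and `overlap V U` for `|tr (Vᴴ U)| / d`. Apply the difference of the
two twirls to the maximally entangled state and take the quadratic form at the Choi vector of
`V^{⊗k}`. The ensemble contributes the mean of `overlap ^ (2k)`. The Haar twirl is a projection onto
the commutant of the `U^{⊗k}`, so it contributes the dimension of that commutant divided by
`d^{2k}`. By the relevant half of Schur–Weyl duality (`unitaryCommutant_le_permSpan`) this is at
most `k!/d^{2k}`. The diamond norm controls the difference, so the mean is at most `B = (k!/d^{2k})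
(1 + ε)` for every `V` (`IsApproxDesign.sum_weight_mul_overlap_le`).

Markov's inequality gives two bounds: one unitary carries weight at most `B`, and the unitaries
`δ`-close to `V` carry at most `B / (1 - δ²)^k`, because closeness forces `overlap² ≥ 1 - δ²`
(`one_sub_sq_le_overlap_sq`). Each unitary of positive weight is either complex or close to one of
at most `(n |G|)^r` circuits (`exists_finset_circuits_subset`). Summing the weights to 1 and
dividing by `B` gives the claim. -/

namespace QComplexity

/-! ### Trace norm estimates and pure-state fidelity -/

section TraceNorm

open scoped ComplexOrder

theorem vecMulVec_mul_vecMulVec_eq_smul {ι : Type*} [Fintype ι] (a b c d : ι → ℂ) :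
    Matrix.vecMulVec a b * Matrix.vecMulVec c d = (b ⬝ᵥ c) • Matrix.vecMulVec a d := by
  rw [Matrix.vecMulVec_mul_vecMulVec, Matrix.vecMulVec_smul]

theorem vecMulVec_mul_self_star {ι : Type*} [Fintype ι] (v : ι → ℂ) (hv : star v ⬝ᵥ v = 1) :
    Matrix.vecMulVec v (star v) * Matrix.vecMulVec v (star v) = Matrix.vecMulVec v (star v) := by
  rw [vecMulVec_mul_vecMulVec_eq_smul, hv, one_smul]

theorem conjTranspose_vecMulVec_self_star {ι : Type*} (v : ι → ℂ) :
    (Matrix.vecMulVec v (star v)).conjTranspose = Matrix.vecMulVec v (star v) := by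
  rw [Matrix.conjTranspose_vecMulVec, star_star]

variable {ι : Type*} [Fintype ι] [DecidableEq ι]

theorem eigenvalues_sq_of_mul_self {A : Matrix ι ι ℂ} (hA : A.IsHermitian) {c : ℝ}
    (h : A * A = (c : ℂ) • A) (i : ι) :
    hA.eigenvalues i * hA.eigenvalues i = c * hA.eigenvalues i := by
  have h1 := hA.mulVec_eigenvectorBasis i
  set v : ι → ℂ := (hA.eigenvectorBasis i).ofLp with hv
  have hne : v ≠ 0 := by
    intro h0
    apply hA.eigenvectorBasis.orthonormal.ne_zero i
    ext j
    exact congrFun h0 j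
  have h2 : (A * A).mulVec v = ((hA.eigenvalues i * hA.eigenvalues i : ℝ) : ℂ) • v := by
    rw [← Matrix.mulVec_mulVec, h1, Matrix.mulVec_smul, h1, smul_smul, RCLike.real_smul_eq_coe_smul (K := ℂ)]
    simp
  rw [h, Matrix.smul_mulVec, h1, RCLike.real_smul_eq_coe_smul (K := ℂ), smul_smul] at h2
  have h3 := smul_left_injective ℂ hne h2
  exact Complex.ofReal_injective (by push_cast at h3 ⊢; exact h3.symm)

/-- Every eigenvalue of `Xᴴ X` is 0 or `c`, so each singular value times `√c` is the corresponding
eigenvalue. The product form avoids dividing by `√c`. -/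
theorem traceNorm_mul_sqrt {X : Matrix ι ι ℂ} {c : ℝ}
    (h : (X.conjTranspose * X) * (X.conjTranspose * X) = (c : ℂ) • (X.conjTranspose * X)) :
    traceNorm X * √c = (X.conjTranspose * X).trace.re := by
  have hA := Matrix.isHermitian_conjTranspose_mul_self X
  have htr : (X.conjTranspose * X).trace.re = ∑ i, hA.eigenvalues i := by
    rw [hA.trace_eq_sum_eigenvalues]
    simp
  rw [htr, traceNorm, Finset.sum_mul]
  refine Finset.sum_congr rfl fun i _ => ?_
  have h1 := eigenvalues_sq_of_mul_self hA h i
  have h0 : 0 ≤ hA.eigenvalues i := (Matrix.posSemidef_conjTranspose_mul_self X).eigenvalues_nonneg i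
  rcases h0.eq_or_lt with h2 | h2
  · rw [← h2]; simp
  · rw [← mul_right_cancel₀ h2.ne' h1, Real.mul_self_sqrt h0]

/-- The quadratic form of `X` at a unit vector is bounded by the trace norm of `X`. -/
theorem norm_quadraticForm_le_traceNorm (X : Matrix ι ι ℂ) {v : ι → ℂ}
    (hv : star v ⬝ᵥ v = 1) : ‖star v ⬝ᵥ X.mulVec v‖ ≤ traceNorm X := by
  have hA := Matrix.isHermitian_conjTranspose_mul_self X
  set x : EuclideanSpace ℂ ι := WithLp.toLp 2 v with hx
  set y : EuclideanSpace ℂ ι := WithLp.toLp 2 (X.mulVec v) with hy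
  set u := hA.eigenvectorBasis with hu
  have hpos : ∀ i, 0 ≤ hA.eigenvalues i := fun i =>
    (Matrix.posSemidef_conjTranspose_mul_self X).eigenvalues_nonneg i
  have hT : 0 ≤ traceNorm X := Finset.sum_nonneg fun i _ => Real.sqrt_nonneg _
  -- A single singular value is at most their sum; this bounds `‖X v‖`, and Cauchy–Schwarz then
  -- finishes.
  have hle : ∀ i, hA.eigenvalues i ≤ traceNorm X ^ 2 := fun i => by
    rw [← Real.sq_sqrt (hpos i)]
    gcongr
    exact Finset.single_le_sum (f := fun i => √(hA.eigenvalues i))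
      (fun i _ => Real.sqrt_nonneg _) (Finset.mem_univ i)
  have hx1 : ‖x‖ = 1 := by
    have h : inner ℂ x x = 1 := by
      rw [EuclideanSpace.inner_eq_star_dotProduct, dotProduct_comm, ← hv]
    rw [inner_self_eq_norm_sq_to_K] at h
    have h' : ‖x‖ ^ 2 = 1 := by exact Complex.ofReal_injective (by push_cast; exact h)
    nlinarith [norm_nonneg x]
  have hxy : star v ⬝ᵥ X.mulVec v = inner ℂ x y := by
    rw [EuclideanSpace.inner_eq_star_dotProduct, dotProduct_comm]
  have hBi : ∀ i, inner ℂ (u i) (WithLp.toLp 2 ((X.conjTranspose * X).mulVec v)) =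
      (hA.eigenvalues i : ℂ) * inner ℂ (u i) x := fun i => by
    have h1 := hA.mulVec_eigenvectorBasis i
    rw [EuclideanSpace.inner_eq_star_dotProduct, EuclideanSpace.inner_eq_star_dotProduct,
      dotProduct_comm, Matrix.dotProduct_mulVec]
    conv_lhs => rw [← hA.eq, ← Matrix.star_mulVec, h1]
    rw [RCLike.real_smul_eq_coe_smul (K := ℂ), star_smul, smul_dotProduct, dotProduct_comm]
    simp [hx, hu]
  have hyy : ‖y‖ ^ 2 = ∑ i, hA.eigenvalues i * ‖inner ℂ (u i) x‖ ^ 2 := by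
    have h1 : inner ℂ y y = inner ℂ x (WithLp.toLp 2 ((X.conjTranspose * X).mulVec v)) := by
      rw [EuclideanSpace.inner_eq_star_dotProduct, EuclideanSpace.inner_eq_star_dotProduct,
        dotProduct_comm, dotProduct_comm ((X.conjTranspose * X).mulVec v), Matrix.star_mulVec,
        ← Matrix.dotProduct_mulVec, Matrix.mulVec_mulVec]
    rw [inner_self_eq_norm_sq_to_K, ← u.sum_inner_mul_inner] at h1
    have h2 : ∀ i, inner ℂ x (u i) *
        inner ℂ (u i) (WithLp.toLp 2 ((X.conjTranspose * X).mulVec v)) =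
        ((hA.eigenvalues i * ‖inner ℂ (u i) x‖ ^ 2 : ℝ) : ℂ) := fun i => by
      rw [hBi, ← inner_conj_symm x (u i), mul_left_comm, RCLike.conj_mul]
      push_cast
      rfl
    simp only [h2] at h1
    exact Complex.ofReal_injective (by push_cast at h1 ⊢; exact h1)
  have hyle : ‖y‖ ^ 2 ≤ traceNorm X ^ 2 := by
    rw [hyy]
    calc _ ≤ ∑ i, traceNorm X ^ 2 * ‖inner ℂ (u i) x‖ ^ 2 := by
          gcongr with i _
          exact hle i
      _ = traceNorm X ^ 2 := by rw [← Finset.mul_sum, u.sum_sq_norm_inner_right, hx1]; simp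
  rw [hxy]
  calc ‖inner ℂ x y‖ ≤ ‖x‖ * ‖y‖ := norm_inner_le_norm x y
    _ ≤ traceNorm X := by
        rw [hx1, one_mul]
        exact le_of_sq_le_sq hyle hT

theorem traceNorm_vecMulVec_self_star {v : ι → ℂ} (hv : star v ⬝ᵥ v = 1) :
    traceNorm (Matrix.vecMulVec v (star v)) = 1 := by
  have h := traceNorm_mul_sqrt (X := Matrix.vecMulVec v (star v)) (c := 1) (by
    simp [vecMulVec_mul_self_star v hv])
  rw [conjTranspose_vecMulVec_self_star, vecMulVec_mul_self_star v hv, Matrix.trace_vecMulVec,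
    dotProduct_comm, hv] at h
  simpa using h

/-- Two pure states at half trace distance at most `δ` have fidelity at least `1 - δ ^ 2`. -/
theorem one_sub_sq_le_of_traceNorm_sub_le {a b : ι → ℂ} (ha : star a ⬝ᵥ a = 1)
    (hb : star b ⬝ᵥ b = 1) {δ : ℝ} (hδ : 0 ≤ δ)
    (h : traceNorm (Matrix.vecMulVec a (star a) - Matrix.vecMulVec b (star b)) / 2 ≤ δ) :
    1 - δ ^ 2 ≤ ‖star b ⬝ᵥ a‖ ^ 2 := by
  set P := Matrix.vecMulVec a (star a) with hP
  set Q := Matrix.vecMulVec b (star b) with hQ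
  set f : ℝ := ‖star b ⬝ᵥ a‖ ^ 2 with hf
  have hab : star a ⬝ᵥ b = star (star b ⬝ᵥ a) := by
    rw [Matrix.star_dotProduct, dotProduct_comm]
  have hfc : (star a ⬝ᵥ b) * (star b ⬝ᵥ a) = (f : ℂ) := by
    rw [hab, hf]
    simpa using RCLike.conj_mul (star b ⬝ᵥ a)
  have hPP : P * P = P := vecMulVec_mul_self_star a ha
  have hQQ : Q * Q = Q := vecMulVec_mul_self_star b hb
  have hPQ : P * Q = (star a ⬝ᵥ b) • Matrix.vecMulVec a (star b) :=
    vecMulVec_mul_vecMulVec_eq_smul ..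
  have hQP : Q * P = (star b ⬝ᵥ a) • Matrix.vecMulVec b (star a) :=
    vecMulVec_mul_vecMulVec_eq_smul ..
  have hPQP : P * Q * P = (f : ℂ) • P := by
    rw [hPQ, Matrix.smul_mul, vecMulVec_mul_vecMulVec_eq_smul, smul_smul, hfc]
  have hQPQ : Q * P * Q = (f : ℂ) • Q := by
    rw [hQP, Matrix.smul_mul, vecMulVec_mul_vecMulVec_eq_smul, smul_smul, mul_comm, hfc]
  have hZ : (P - Q).conjTranspose = P - Q := by
    rw [Matrix.conjTranspose_sub, hP, hQ, conjTranspose_vecMulVec_self_star,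
      conjTranspose_vecMulVec_self_star]
  have hZ2 : (P - Q) * (P - Q) = P + Q - P * Q - Q * P := by
    rw [sub_mul, mul_sub, mul_sub, hPP, hQQ]; abel
  -- The identity `(P - Q)³ = (1 - f)(P - Q)` leaves only the singular values 0 and `√(1 - f)`. With
  -- the trace below, the trace norm is `2 √(1 - f)` when `f < 1`.
  have hZ4 : (P - Q) * (P - Q) * ((P - Q) * (P - Q)) =
      ((1 - f : ℝ) : ℂ) • ((P - Q) * (P - Q)) := by
    have h3 : (P - Q) * ((P - Q) * (P - Q)) = ((1 - f : ℝ) : ℂ) • (P - Q) := by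
      have e1 : P * (P + Q - P * Q - Q * P) = P - (f : ℂ) • P := by
        simp only [mul_add, mul_sub, ← mul_assoc, hPP, hPQP]; abel
      have e2 : Q * (P + Q - P * Q - Q * P) = Q - (f : ℂ) • Q := by
        simp only [mul_add, mul_sub, ← mul_assoc, hQQ, hQPQ]; abel
      rw [hZ2, sub_mul, e1, e2]
      push_cast
      module
    rw [mul_assoc, h3, Matrix.mul_smul]
  have htr : ((P - Q) * (P - Q)).trace.re = 2 * (1 - f) := by
    rw [hZ2, Matrix.trace_sub, Matrix.trace_sub, Matrix.trace_add, hPQ, hQP, Matrix.trace_smul,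
      Matrix.trace_smul, hP, hQ]
    simp only [Matrix.trace_vecMulVec]
    rw [dotProduct_comm a, dotProduct_comm b, ha, hb, dotProduct_comm a, dotProduct_comm b,
      smul_eq_mul, smul_eq_mul, hfc, mul_comm, hfc]
    simp
    ring
  have hmain := traceNorm_mul_sqrt (X := P - Q) (c := 1 - f) (by rw [hZ]; exact hZ4)
  rw [hZ, htr] at hmain
  rcases le_or_gt (1 - f) 0 with h0 | h0
  · nlinarith [sq_nonneg δ]
  · have hs : 0 < √(1 - f) := Real.sqrt_pos.mpr h0
    have hss : √(1 - f) * √(1 - f) = 1 - f := Real.mul_self_sqrt h0.le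
    have : √(1 - f) ≤ δ := by nlinarith
    nlinarith

end TraceNorm
-- Tensor powers of matrices
section TensorPow

variable {ι : Type*} {k : ℕ}

theorem tensorPow_mul [Fintype ι] (A B : Matrix ι ι ℂ) :
    tensorPow k (A * B) = tensorPow k A * tensorPow k B := by
  classical
  ext a b
  simp only [tensorPow, Matrix.of_apply, Matrix.mul_apply, ← Finset.prod_mul_distrib]
  rw [Finset.prod_univ_sum, Fintype.piFinset_univ]

theorem tensorPow_conjTranspose (A : Matrix ι ι ℂ) :
    tensorPow k A.conjTranspose = (tensorPow k A).conjTranspose := by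
  ext a b
  simp [tensorPow]

theorem tensorPow_diagonal [DecidableEq ι] (z : ι → ℂ) :
    tensorPow k (Matrix.diagonal z) = Matrix.diagonal fun a => ∏ l, z (a l) := by
  ext a b
  simp only [tensorPow, Matrix.of_apply, Matrix.diagonal_apply]
  split_ifs with h
  · subst h
    simp
  · obtain ⟨l, hl⟩ := Function.ne_iff.mp h
    exact Finset.prod_eq_zero (Finset.mem_univ l) (if_neg hl)

theorem tensorPow_one [DecidableEq ι] : tensorPow k (1 : Matrix ι ι ℂ) = 1 := by
  rw [← Matrix.diagonal_one, tensorPow_diagonal]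
  simp

theorem trace_tensorPow [Fintype ι] (A : Matrix ι ι ℂ) :
    (tensorPow k A).trace = A.trace ^ k := by
  classical
  simp only [Matrix.trace, Matrix.diag, tensorPow, Matrix.of_apply]
  rw [← Fin.prod_const, Finset.prod_univ_sum, Fintype.piFinset_univ]

theorem tensorPow_mem_unitaryGroup [Fintype ι] [DecidableEq ι] (U : Matrix.unitaryGroup ι ℂ) :
    tensorPow k (U : Matrix ι ι ℂ) ∈ Matrix.unitaryGroup (Fin k → ι) ℂ := by
  rw [Matrix.mem_unitaryGroup_iff, Matrix.star_eq_conjTranspose, ← tensorPow_conjTranspose,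
    ← tensorPow_mul, ← Matrix.star_eq_conjTranspose, Matrix.mem_unitaryGroup_iff.mp U.2,
    tensorPow_one]

end TensorPow

/-! ### Schur–Weyl duality: the commutant of the `U^{⊗k}` has dimension at most `k!` -/

section SchurWeyl

variable {ι : Type*} {k : ℕ}

/-- Permutation of the tensor factors, acting on matrices by left multiplication. -/
def permuteRows (ι : Type*) {k : ℕ} (σ : Equiv.Perm (Fin k)) :
    Matrix (Fin k → ι) (Fin k → ι) ℂ →ₗ[ℂ] Matrix (Fin k → ι) (Fin k → ι) ℂ where
  toFun Y := Y.submatrix (fun a => a ∘ σ) id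
  map_add' _ _ := rfl
  map_smul' _ _ := rfl

theorem permuteRows_permuteRows (σ τ : Equiv.Perm (Fin k))
    (Y : Matrix (Fin k → ι) (Fin k → ι) ℂ) :
    permuteRows ι τ (permuteRows ι σ Y) = permuteRows ι (τ * σ) Y := rfl

/-- The exponent of the monomial `∏ l, z (a l, b l)`. -/
noncomputable def pairCount (a b : Fin k → ι) : ι × ι →₀ ℕ := ∑ l, Finsupp.single (a l, b l) 1

variable [DecidableEq ι]

/-- Equal exponents mean that each pair of indices occurs equally often, so bijections between the
fibres glue to a permutation of the positions. -/
theorem exists_perm_of_pairCount_eq {a b a' b' : Fin k → ι}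
    (h : pairCount a b = pairCount a' b') :
    ∃ σ : Equiv.Perm (Fin k), a' ∘ σ = a ∧ b' ∘ σ = b := by
  have hcard : ∀ (a b : Fin k → ι) (c : ι × ι),
      pairCount a b c = Fintype.card {l // (a l, b l) = c} := fun a b c => by
    rw [pairCount, Finsupp.finsetSum_apply, Fintype.card_subtype, Finset.card_filter]
    simp [Finsupp.single_apply]
  have e : ∀ c, Nonempty ({l // (a l, b l) = c} ≃ {l // (a' l, b' l) = c}) := fun c =>
    ⟨Fintype.equivOfCardEq (by rw [← hcard, ← hcard, h])⟩
  let σ := Equiv.ofFiberEquiv (f := fun l => (a l, b l)) (g := fun l => (a' l, b' l))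
    fun c => (e c).some
  have hσ : ∀ l, (a' (σ l), b' (σ l)) = (a l, b l) := fun l =>
    Equiv.ofFiberEquiv_map (f := fun l => (a l, b l)) (g := fun l => (a' l, b' l)) _ l
  exact ⟨σ, funext fun l => (Prod.ext_iff.mp (hσ l)).1, funext fun l => (Prod.ext_iff.mp (hσ l)).2⟩

/-- The span of the permutations of the tensor factors. -/
def permSpan (ι : Type*) [DecidableEq ι] (k : ℕ) :
    Submodule ℂ (Matrix (Fin k → ι) (Fin k → ι) ℂ) :=
  Submodule.span ℂ (Set.range fun σ : Equiv.Perm (Fin k) => permuteRows ι σ 1)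

theorem permuteRows_mem_permSpan (τ : Equiv.Perm (Fin k))
    {Y : Matrix (Fin k → ι) (Fin k → ι) ℂ} (hY : Y ∈ permSpan ι k) :
    permuteRows ι τ Y ∈ permSpan ι k := by
  refine Submodule.span_induction (p := fun Y _ => permuteRows ι τ Y ∈ permSpan ι k)
    ?_ ?_ ?_ ?_ hY
  · rintro _ ⟨σ, rfl⟩
    exact Submodule.subset_span ⟨τ * σ, rfl⟩
  · rw [map_zero]
    exact zero_mem _
  · intro _ _ _ _ h1 h2
    rw [map_add]
    exact add_mem h1 h2
  · intro c _ _ h1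
    rw [map_smul]
    exact Submodule.smul_mem _ c h1

theorem finrank_permSpan_le : Module.finrank ℂ (permSpan ι k) ≤ k.factorial := by
  have h := finrank_range_le_card (R := ℂ)
    (fun σ : Equiv.Perm (Fin k) => permuteRows ι σ (1 : Matrix (Fin k → ι) (Fin k → ι) ℂ))
  rwa [Fintype.card_perm, Fintype.card_fin] at h

variable [Fintype ι]

theorem infinite_unitCircle : (Metric.sphere (0 : ℂ) 1).Infinite := by
  refine (isPreconnected_sphere (by rw [Complex.rank_real_complex]; norm_num) 0 1).infinite_of_nontrivial
    ⟨1, by simp, -1, by simp, ?_⟩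
  intro h
  have := congrArg Complex.re h
  norm_num at this

/-- Each entry of the commutation relation is polynomial in `z` and holds on the torus of unitary
diagonal matrices, which is Zariski dense. -/
theorem commute_tensorPow_diagonal {X : Matrix (Fin k → ι) (Fin k → ι) ℂ}
    (hX : ∀ U : Matrix.unitaryGroup ι ℂ, Commute X (tensorPow k (U : Matrix ι ι ℂ)))
    (z : ι → ℂ) : Commute X (tensorPow k (Matrix.diagonal z)) := by
  ext a b
  rw [tensorPow_diagonal, Matrix.mul_diagonal, Matrix.diagonal_mul]
  have key : (MvPolynomial.C (X a b) * ∏ l, MvPolynomial.X (b l) : MvPolynomial ι ℂ) =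
      (∏ l, MvPolynomial.X (a l)) * MvPolynomial.C (X a b) := by
    refine MvPolynomial.funext_set (fun _ => Metric.sphere (0 : ℂ) 1)
      (fun _ => infinite_unitCircle) fun w hw => ?_
    have hU : Matrix.diagonal w ∈ Matrix.unitaryGroup ι ℂ := by
      rw [Matrix.mem_unitaryGroup_iff, Matrix.star_eq_conjTranspose,
        Matrix.diagonal_conjTranspose, Matrix.diagonal_mul_diagonal, ← Matrix.diagonal_one]
      congr 1
      funext i
      have hi : ‖w i‖ = 1 := by simpa using hw i (Set.mem_univ i)
      have := RCLike.mul_conj (w i)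
      simpa [hi] using this
    have h := congrFun (congrFun (hX ⟨_, hU⟩).eq a) b
    rw [tensorPow_diagonal, Matrix.mul_diagonal, Matrix.diagonal_mul] at h
    simpa using h
  simpa using congrArg (MvPolynomial.eval z) key

theorem commute_tensorPow_of_isHermitian {X : Matrix (Fin k → ι) (Fin k → ι) ℂ}
    (hX : ∀ U : Matrix.unitaryGroup ι ℂ, Commute X (tensorPow k (U : Matrix ι ι ℂ)))
    {H : Matrix ι ι ℂ} (hH : H.IsHermitian) : Commute X (tensorPow k H) := by
  rw [hH.spectral_theorem, Unitary.conjStarAlgAut_apply, tensorPow_mul, tensorPow_mul]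
  exact ((hX _).mul_right (commute_tensorPow_diagonal hX _)).mul_right
    (hX (star hH.eigenvectorUnitary))

/-- Unitarian trick: with `A = H + iK`, the commutator with `(H + tK)^{⊗k}` is polynomial in `t` and
vanishes for real `t`, where `H + tK` is Hermitian; hence it vanishes at `t = i`. -/
theorem commute_tensorPow {X : Matrix (Fin k → ι) (Fin k → ι) ℂ}
    (hX : ∀ U : Matrix.unitaryGroup ι ℂ, Commute X (tensorPow k (U : Matrix ι ι ℂ)))
    (A : Matrix ι ι ℂ) : Commute X (tensorPow k A) := by
  set H : Matrix ι ι ℂ := (realPart A : Matrix ι ι ℂ) with hH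
  set K : Matrix ι ι ℂ := (imaginaryPart A : Matrix ι ι ℂ) with hK
  have hHs : H.IsHermitian := (realPart A).2
  have hKs : K.IsHermitian := (imaginaryPart A).2
  have hA : A = H + Complex.I • K := (realPart_add_I_smul_imaginaryPart A).symm
  have hreal : ∀ t : ℝ, Commute X (tensorPow k (H + (t : ℂ) • K)) := fun t => by
    refine commute_tensorPow_of_isHermitian hX (hHs.add ?_)
    rw [Matrix.IsHermitian, Matrix.conjTranspose_smul, hKs.eq]
    simp
  let p : (Fin k → ι) → (Fin k → ι) → Polynomial ℂ := fun a b =>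
    ∏ l, (Polynomial.C (H (a l) (b l)) + Polynomial.X * Polynomial.C (K (a l) (b l)))
  have hp : ∀ (t : ℂ) a b, (p a b).eval t = tensorPow k (H + t • K) a b := fun t a b => by
    simp [p, tensorPow, Polynomial.eval_prod, mul_comm t]
  rw [hA]
  ext a b
  let f : Polynomial ℂ :=
    ∑ c, Polynomial.C (X a c) * p c b - ∑ c, p a c * Polynomial.C (X c b)
  have hf : ∀ t : ℂ, f.eval t =
      (X * tensorPow k (H + t • K)) a b - (tensorPow k (H + t • K) * X) a b := fun t => by
    simp [f, Polynomial.eval_finsetSum, hp, Matrix.mul_apply]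
  have hf0 : f = 0 := by
    refine f.eq_zero_of_infinite_isRoot
      ((Set.infinite_range_of_injective Complex.ofReal_injective).mono ?_)
    rintro _ ⟨t, rfl⟩
    change f.eval (t : ℂ) = 0
    rw [hf, (hreal t).eq, sub_self]
  have := hf Complex.I
  rw [hf0, Polynomial.eval_zero] at this
  exact (sub_eq_zero.mp this.symm)

/-- A matrix commuting with all tensor powers commutes with the symmetric matrices that are
supported on one orbit of pairs of indices. -/
theorem commute_orbitMatrix {X : Matrix (Fin k → ι) (Fin k → ι) ℂ}
    (hX : ∀ A : Matrix ι ι ℂ, Commute X (tensorPow k A)) (m : ι × ι →₀ ℕ) :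
    Commute X (Matrix.of fun a b => if pairCount a b = m then 1 else 0) := by
  have hmono : ∀ a b : Fin k → ι, (∏ l, MvPolynomial.X (a l, b l) : MvPolynomial (ι × ι) ℂ) =
      MvPolynomial.monomial (pairCount a b) 1 := fun a b => by
    rw [pairCount, MvPolynomial.monomial_sum_one]
    rfl
  ext a b
  -- This is commutation with the tensor power of a generic matrix whose entries are indeterminates;
  -- comparing coefficients at `m` isolates one orbit.
  have key : (∑ c, MvPolynomial.C (X a c) * ∏ l, MvPolynomial.X (c l, b l) :
      MvPolynomial (ι × ι) ℂ) = ∑ c, MvPolynomial.C (X c b) * ∏ l, MvPolynomial.X (a l, c l) := by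
    refine MvPolynomial.funext fun z => ?_
    have h := congrFun (congrFun (hX (Matrix.of fun i j => z (i, j))).eq a) b
    simpa [Matrix.mul_apply, tensorPow, mul_comm (X _ b)] using h
  have h := congrArg (MvPolynomial.coeff m) key
  simp only [hmono, MvPolynomial.coeff_sum, MvPolynomial.coeff_C_mul,
    MvPolynomial.coeff_monomial] at h
  simpa [Matrix.mul_apply] using h

/-- A symmetric `Y` is constant on orbits of index pairs, hence a combination of orbit indicators.
-/
theorem commute_of_symmetric {X : Matrix (Fin k → ι) (Fin k → ι) ℂ}
    (hX : ∀ A : Matrix ι ι ℂ, Commute X (tensorPow k A))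
    {Y : Matrix (Fin k → ι) (Fin k → ι) ℂ}
    (hY : ∀ (σ : Equiv.Perm (Fin k)) a b, Y (a ∘ σ) (b ∘ σ) = Y a b) : Commute X Y := by
  classical
  let S : Finset (ι × ι →₀ ℕ) :=
    Finset.univ.image fun x : (Fin k → ι) × (Fin k → ι) => pairCount x.1 x.2
  have hex : ∀ m : ι × ι →₀ ℕ, ∃ y : ℂ, ∀ a b, pairCount a b = m → Y a b = y := fun m => by
    by_cases h : ∃ a b : Fin k → ι, pairCount a b = m
    · obtain ⟨a, b, rfl⟩ := h
      refine ⟨Y a b, fun a' b' h' => ?_⟩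
      obtain ⟨σ, rfl, rfl⟩ := exists_perm_of_pairCount_eq h'
      exact hY σ a b
    · exact ⟨0, fun a b hab => (h ⟨a, b, hab⟩).elim⟩
  choose y hy using hex
  have hYS : Y = ∑ m ∈ S, y m • Matrix.of fun a b => if pairCount a b = m then (1 : ℂ) else 0 := by
    ext a b
    rw [Matrix.sum_apply, Finset.sum_eq_single (pairCount a b)]
    · simpa using hy _ a b rfl
    · intro m _ hm
      simp [hm.symm]
    · intro h
      exact (h (Finset.mem_image.mpr ⟨(a, b), Finset.mem_univ _, rfl⟩)).elim
  rw [hYS]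
  exact Commute.sum_right _ _ _ fun m _ => (commute_orbitMatrix hX m).smul_right _

/-- Maschke's argument: average the conjugates of an arbitrary linear projection over the symmetric
group. -/
theorem exists_equivariant_projection (ι : Type*) [Fintype ι] [DecidableEq ι] (k : ℕ) :
    ∃ p : Matrix (Fin k → ι) (Fin k → ι) ℂ →ₗ[ℂ] Matrix (Fin k → ι) (Fin k → ι) ℂ,
      (∀ Y, p Y ∈ permSpan ι k) ∧ (∀ Y ∈ permSpan ι k, p Y = Y) ∧
      ∀ τ Y, p (permuteRows ι τ Y) = permuteRows ι τ (p Y) := by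
  obtain ⟨g, hg⟩ := LinearMap.exists_leftInverse_of_injective (permSpan ι k).subtype
    (Submodule.ker_subtype _)
  set p₀ := (permSpan ι k).subtype ∘ₗ g with hp₀
  have hmem : ∀ Y, p₀ Y ∈ permSpan ι k := fun Y => (g Y).2
  have hid : ∀ Y ∈ permSpan ι k, p₀ Y = Y := fun Y hY =>
    congrArg Subtype.val (LinearMap.congr_fun hg ⟨Y, hY⟩)
  refine ⟨(Fintype.card (Equiv.Perm (Fin k)) : ℂ)⁻¹ •
    ∑ σ : Equiv.Perm (Fin k), permuteRows ι σ ∘ₗ p₀ ∘ₗ permuteRows ι σ⁻¹, ?_, ?_, ?_⟩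
  · intro Y
    simp only [LinearMap.smul_apply, LinearMap.sum_apply, LinearMap.comp_apply]
    exact Submodule.smul_mem _ _ (Submodule.sum_mem _ fun σ _ =>
      permuteRows_mem_permSpan σ (hmem _))
  · intro Y hY
    have h : ∀ σ : Equiv.Perm (Fin k),
        permuteRows ι σ (p₀ (permuteRows ι σ⁻¹ Y)) = Y := fun σ => by
      rw [hid _ (permuteRows_mem_permSpan _ hY), permuteRows_permuteRows, mul_inv_cancel]
      rfl
    simp only [LinearMap.smul_apply, LinearMap.sum_apply, LinearMap.comp_apply, h]
    rw [Finset.sum_const, Finset.card_univ, ← Nat.cast_smul_eq_nsmul ℂ, smul_smul,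
      inv_mul_cancel₀ (Nat.cast_ne_zero.mpr Fintype.card_ne_zero), one_smul]
  · intro τ Y
    simp only [LinearMap.smul_apply, LinearMap.sum_apply, LinearMap.comp_apply, map_smul, map_sum]
    congr 1
    rw [← Equiv.sum_comp (Equiv.mulLeft τ)]
    refine Finset.sum_congr rfl fun σ _ => ?_
    simp only [permuteRows_permuteRows, Equiv.coe_mulLeft]
    congr 3
    group

/-- The double commutant of the permutations of the tensor factors is their span. -/
theorem mem_permSpan_of_commute {X : Matrix (Fin k → ι) (Fin k → ι) ℂ}
    (hX : ∀ Y : Matrix (Fin k → ι) (Fin k → ι) ℂ,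
      (∀ (σ : Equiv.Perm (Fin k)) a b, Y (a ∘ σ) (b ∘ σ) = Y a b) → Commute X Y) :
    X ∈ permSpan ι k := by
  obtain ⟨p, hmem, hid, hequiv⟩ := exists_equivariant_projection ι k
  -- The blocks of `p` with column indices `c`, `e` fixed. Permutations act on rows only, so
  -- equivariance of `p` makes each block symmetric. Thus `X` commutes with the blocks, `p` commutes
  -- with left multiplication by `X`, and `X = X * p 1 = p X` lies in the span.
  let Q : (Fin k → ι) → (Fin k → ι) → Matrix (Fin k → ι) (Fin k → ι) ℂ := fun c e =>
    Matrix.of fun a b => p (Matrix.single b e 1) a c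
  have hp : ∀ Y a c, p Y a c = ∑ e, (Q c e * Y) a e := fun Y a c => by
    conv_lhs => rw [Matrix.matrix_eq_sum_single Y]
    simp only [map_sum, Matrix.sum_apply, Matrix.mul_apply]
    rw [Finset.sum_comm]
    refine Finset.sum_congr rfl fun e _ => Finset.sum_congr rfl fun b _ => ?_
    have : Matrix.single b e (Y b e) = Y b e • Matrix.single b e (1 : ℂ) := by
      rw [Matrix.smul_single, smul_eq_mul, mul_one]
    rw [this, map_smul, Matrix.smul_apply, smul_eq_mul, mul_comm]
    rfl
  have hQ : ∀ c e, Commute X (Q c e) := fun c e => hX _ fun σ a b => by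
    have h := congrFun (congrFun (hequiv σ (Matrix.single (b ∘ σ) e 1)) a) c
    have hs : permuteRows ι σ (Matrix.single (b ∘ σ) e 1) = Matrix.single b e 1 := by
      ext x y
      change Matrix.single (b ∘ σ) e (1 : ℂ) (x ∘ σ) y = _
      have : b ∘ σ = x ∘ σ ↔ b = x := σ.surjective.injective_comp_right.eq_iff
      simp only [Matrix.single_apply, this]
    rw [hs] at h
    exact h.symm
  have hcomm : ∀ Y, p (X * Y) = X * p Y := fun Y => by
    ext a c
    rw [hp, Matrix.mul_apply]
    simp only [hp, Finset.mul_sum]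
    rw [Finset.sum_comm]
    refine Finset.sum_congr rfl fun e _ => ?_
    rw [← mul_assoc, ← (hQ c e).eq, mul_assoc, Matrix.mul_apply]
  have h1 : (1 : Matrix (Fin k → ι) (Fin k → ι) ℂ) ∈ permSpan ι k :=
    Submodule.subset_span ⟨1, rfl⟩
  have h := hcomm 1
  rw [hid 1 h1, mul_one] at h
  rw [← h]
  exact hmem X

/-- The commutant of the tensor powers of the unitaries. -/
def unitaryCommutant (ι : Type*) [Fintype ι] [DecidableEq ι] (k : ℕ) :
    Submodule ℂ (Matrix (Fin k → ι) (Fin k → ι) ℂ) where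
  carrier := {X | ∀ U : Matrix.unitaryGroup ι ℂ, Commute X (tensorPow k (U : Matrix ι ι ℂ))}
  add_mem' hX hY U := (hX U).add_left (hY U)
  zero_mem' _ := Commute.zero_left _
  smul_mem' c _ hX U := (hX U).smul_left c

theorem unitaryCommutant_le_permSpan : unitaryCommutant ι k ≤ permSpan ι k := fun _ hX =>
  mem_permSpan_of_commute fun _ hY => commute_of_symmetric (commute_tensorPow hX) hY

theorem finrank_unitaryCommutant_le : Module.finrank ℂ (unitaryCommutant ι k) ≤ k.factorial :=
  (Submodule.finrank_mono unitaryCommutant_le_permSpan).trans finrank_permSpan_le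

end SchurWeyl
-- The Haar twirl as a projection onto the commutant
section HaarTwirl

variable {ι : Type*} [Fintype ι] [DecidableEq ι] {k : ℕ}

instance isProbabilityMeasure_haarUnitary : IsProbabilityMeasure (haarUnitary ι) :=
  ⟨Measure.haarMeasure_self⟩

instance isMulLeftInvariant_haarUnitary : (haarUnitary ι).IsMulLeftInvariant :=
  Measure.isMulLeftInvariant_haarMeasure _

theorem mul_haarTwirl_mul (A B X : Matrix (Fin k → ι) (Fin k → ι) ℂ) (a b : Fin k → ι) :
    (A * haarTwirl ι k X * B) a b = ∫ U : Matrix.unitaryGroup ι ℂ,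
      (A * conjChannel (tensorPow k (U : Matrix ι ι ℂ)) X * B) a b ∂(haarUnitary ι) := by
  simp only [Matrix.mul_apply, Finset.sum_mul]
  rw [integral_finsetSum]
  · refine Finset.sum_congr rfl fun c _ => ?_
    rw [integral_finsetSum]
    · refine Finset.sum_congr rfl fun d _ => ?_
      rw [integral_mul_const, integral_const_mul]
      rfl
    · exact fun d _ => ((integrable_conj_entry k X d c).const_mul _).mul_const _
  · exact fun c _ => integrable_finsetSum _ fun d _ =>
      ((integrable_conj_entry k X d c).const_mul _).mul_const _

theorem conj_haarTwirl (V : Matrix.unitaryGroup ι ℂ) (X : Matrix (Fin k → ι) (Fin k → ι) ℂ) :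
    tensorPow k (V : Matrix ι ι ℂ) * haarTwirl ι k X *
      (tensorPow k (V : Matrix ι ι ℂ)).conjTranspose = haarTwirl ι k X := by
  ext a b
  rw [mul_haarTwirl_mul]
  have h : ∀ U : Matrix.unitaryGroup ι ℂ,
      tensorPow k (V : Matrix ι ι ℂ) * conjChannel (tensorPow k (U : Matrix ι ι ℂ)) X *
        (tensorPow k (V : Matrix ι ι ℂ)).conjTranspose =
      conjChannel (tensorPow k ((V * U : Matrix.unitaryGroup ι ℂ) : Matrix ι ι ℂ)) X := fun U => by
    simp only [conjChannel, LinearMap.coe_mk, AddHom.coe_mk, Matrix.UnitaryGroup.mul_val,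
      tensorPow_mul, Matrix.conjTranspose_mul, mul_assoc]
  simp only [h]
  exact integral_mul_left_eq_self (fun U : Matrix.unitaryGroup ι ℂ =>
    conjChannel (tensorPow k (U : Matrix ι ι ℂ)) X a b) V

theorem commute_of_conj_eq {κ : Type*} [Fintype κ] [DecidableEq κ] {W X : Matrix κ κ ℂ}
    (hW : W ∈ Matrix.unitaryGroup κ ℂ) (h : W * X * W.conjTranspose = X) : Commute X W := by
  have hWW : W.conjTranspose * W = 1 := Matrix.mem_unitaryGroup_iff'.mp hW
  change X * W = W * X
  conv_lhs => rw [← h]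
  rw [mul_assoc, hWW, mul_one]

/-- Left invariance of Haar measure puts the image in the commutant; on the commutant the integrand
is constant and the total mass is 1. -/
theorem isProj_haarTwirl : LinearMap.IsProj (unitaryCommutant ι k) (haarTwirl ι k) where
  map_mem X V := commute_of_conj_eq (tensorPow_mem_unitaryGroup V) (conj_haarTwirl V X)
  map_id X hX := by
    ext a b
    have h : ∀ U : Matrix.unitaryGroup ι ℂ,
        conjChannel (tensorPow k (U : Matrix ι ι ℂ)) X = X := fun U => by
      change tensorPow k (U : Matrix ι ι ℂ) * X *
        (tensorPow k (U : Matrix ι ι ℂ)).conjTranspose = X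
      rw [← (hX U).eq, mul_assoc, ← Matrix.star_eq_conjTranspose,
        Matrix.mem_unitaryGroup_iff.mp (tensorPow_mem_unitaryGroup U), mul_one]
    change ∫ U : Matrix.unitaryGroup ι ℂ,
      conjChannel (tensorPow k (U : Matrix ι ι ℂ)) X a b ∂(haarUnitary ι) = X a b
    simp [h]

theorem trace_haarTwirl :
    LinearMap.trace ℂ _ (haarTwirl ι k) = Module.finrank ℂ (unitaryCommutant ι k) :=
  isProj_haarTwirl.trace

theorem trace_eq_sum_single {κ : Type*} [Fintype κ] [DecidableEq κ]
    (Φ : Matrix κ κ ℂ →ₗ[ℂ] Matrix κ κ ℂ) :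
    LinearMap.trace ℂ _ Φ = ∑ s, ∑ t, Φ (Matrix.single s t 1) s t := by
  rw [LinearMap.trace_eq_matrix_trace ℂ (Matrix.stdBasis ℂ κ κ), Matrix.trace,
    Fintype.sum_prod_type]
  refine Finset.sum_congr rfl fun s _ => Finset.sum_congr rfl fun t _ => ?_
  rw [Matrix.diag_apply, LinearMap.toMatrix_apply, Matrix.stdBasis_eq_single]
  rfl

end HaarTwirl

/-! ### Choi vectors and Choi matrices -/

section ChoiVector

variable {κ : Type*} [Fintype κ]

/-- The vector `(A ⊗ 1) Ω`, where `Ω` is the maximally entangled unit vector. -/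
noncomputable def choiVec (A : Matrix κ κ ℂ) : κ × κ → ℂ :=
  fun x => A x.1 x.2 / (√(Fintype.card κ : ℝ) : ℂ)

theorem sqrt_card_mul_self : (√(Fintype.card κ : ℝ) : ℂ) * (√(Fintype.card κ : ℝ) : ℂ) =
    Fintype.card κ := by
  rw [← Complex.ofReal_mul, Real.mul_self_sqrt (Nat.cast_nonneg _)]
  simp

theorem star_choiVec_dotProduct_choiVec (A B : Matrix κ κ ℂ) :
    star (choiVec B) ⬝ᵥ choiVec A = (B.conjTranspose * A).trace / Fintype.card κ := by
  simp only [dotProduct, Fintype.sum_prod_type, choiVec, Pi.star_apply, Matrix.trace,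
    Matrix.diag_apply, Matrix.mul_apply, Matrix.conjTranspose_apply]
  rw [Finset.sum_comm, Finset.sum_div]
  refine Finset.sum_congr rfl fun i _ => ?_
  rw [Finset.sum_div]
  refine Finset.sum_congr rfl fun j _ => ?_
  rw [star_div₀, div_mul_div_comm, ← sqrt_card_mul_self]
  simp

variable [DecidableEq κ]

theorem star_choiVec_dotProduct_self [Nonempty κ] {A : Matrix κ κ ℂ}
    (hA : A ∈ Matrix.unitaryGroup κ ℂ) : star (choiVec A) ⬝ᵥ choiVec A = 1 := by
  rw [star_choiVec_dotProduct_choiVec, ← Matrix.star_eq_conjTranspose,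
    Matrix.mem_unitaryGroup_iff'.mp hA, Matrix.trace_one,
    div_self (Nat.cast_ne_zero.mpr Fintype.card_ne_zero)]

/-- The Choi matrix of `Φ`: the image of the maximally entangled state under `Φ ⊗ id`. -/
noncomputable def choiMatrix (Φ : Matrix κ κ ℂ →ₗ[ℂ] Matrix κ κ ℂ) : Matrix (κ × κ) (κ × κ) ℂ :=
  ampliate κ Φ (Matrix.vecMulVec (choiVec 1) (star (choiVec 1)))

theorem ofReal_traceNorm_choiMatrix_le [Nonempty κ] (Φ : Matrix κ κ ℂ →ₗ[ℂ] Matrix κ κ ℂ) :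
    ENNReal.ofReal (traceNorm (choiMatrix Φ)) ≤ diamondNorm Φ :=
  le_iSup₂_of_le (f := fun (X : Matrix (κ × κ) (κ × κ) ℂ) (_ : traceNorm X ≤ 1) =>
    ENNReal.ofReal (traceNorm (ampliate κ Φ X))) _
    (traceNorm_vecMulVec_self_star (star_choiVec_dotProduct_self (one_mem _))).le le_rfl

theorem choiMatrix_apply (Φ : Matrix κ κ ℂ →ₗ[ℂ] Matrix κ κ ℂ) (a b : κ × κ) :
    choiMatrix Φ a b = Φ (Matrix.single a.2 b.2 1) a.1 b.1 / Fintype.card κ := by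
  have h : (Matrix.of fun i j => Matrix.vecMulVec (choiVec (1 : Matrix κ κ ℂ))
      (star (choiVec 1)) (i, a.2) (j, b.2)) =
      (Fintype.card κ : ℂ)⁻¹ • Matrix.single a.2 b.2 (1 : ℂ) := by
    ext i j
    simp only [Matrix.of_apply, Matrix.vecMulVec_apply, choiVec, Pi.star_apply, Matrix.smul_apply,
      Matrix.one_apply, Matrix.single_apply, ← sqrt_card_mul_self]
    by_cases hi : i = a.2 <;> by_cases hj : j = b.2 <;> simp [hi, hj, eq_comm]
  rw [choiMatrix, ampliate, Matrix.of_apply, h, map_smul, Matrix.smul_apply, smul_eq_mul, div_eq_inv_mul]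

theorem choiMatrix_sub (Φ Ψ : Matrix κ κ ℂ →ₗ[ℂ] Matrix κ κ ℂ) :
    choiMatrix (Φ - Ψ) = choiMatrix Φ - choiMatrix Ψ := rfl

theorem choiMatrix_sum_smul {α : Type*} (s : Finset α) (p : α → ℂ)
    (Φ : α → Matrix κ κ ℂ →ₗ[ℂ] Matrix κ κ ℂ) :
    choiMatrix (∑ i ∈ s, p i • Φ i) = ∑ i ∈ s, p i • choiMatrix (Φ i) := by
  ext a b
  simp only [choiMatrix, ampliate, Matrix.of_apply, LinearMap.sum_apply, LinearMap.smul_apply,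
    Matrix.sum_apply, Matrix.smul_apply]

theorem choiMatrix_conjChannel (A : Matrix κ κ ℂ) :
    choiMatrix (conjChannel A) = Matrix.vecMulVec (choiVec A) (star (choiVec A)) := by
  ext a b
  rw [choiMatrix_apply, conjChannel, LinearMap.coe_mk, AddHom.coe_mk, Matrix.vecMulVec_apply]
  simp only [choiVec, Pi.star_apply, ← sqrt_card_mul_self (κ := κ)]
  rw [star_div₀, div_mul_div_comm]
  congr 1
  · simp [Matrix.mul_apply, Matrix.single_apply, Finset.sum_ite_eq, ite_and]
  · simp

theorem choiForm_conjChannel (A B : Matrix κ κ ℂ) :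
    star (choiVec B) ⬝ᵥ (choiMatrix (conjChannel A)).mulVec (choiVec B) =
      ((‖(B.conjTranspose * A).trace / Fintype.card κ‖ ^ 2 : ℝ) : ℂ) := by
  rw [choiMatrix_conjChannel, Matrix.dotProduct_mulVec, Matrix.vecMul_vecMulVec, smul_dotProduct,
    ← star_choiVec_dotProduct_choiVec, smul_eq_mul]
  have h : star (choiVec A) ⬝ᵥ choiVec B = star (star (choiVec B) ⬝ᵥ choiVec A) := by
    rw [Matrix.star_dotProduct, dotProduct_comm]
  rw [h]
  simpa using RCLike.mul_conj (star (choiVec B) ⬝ᵥ choiVec A)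

/-- The form is the sum of the `(s, t)` entries of `Wᴴ Φ(E_st) W`, normalized; commutation removes
`W` and leaves the trace of `Φ`. This makes the Haar contribution independent of `V`. -/
theorem choiForm_of_commute {Φ : Matrix κ κ ℂ →ₗ[ℂ] Matrix κ κ ℂ} {W : Matrix κ κ ℂ}
    (hW : W ∈ Matrix.unitaryGroup κ ℂ) (h : ∀ X, Commute (Φ X) W) :
    star (choiVec W) ⬝ᵥ (choiMatrix Φ).mulVec (choiVec W) =
      LinearMap.trace ℂ _ Φ / (Fintype.card κ : ℂ) ^ 2 := by
  have hst : ∀ s t, ∑ i, ∑ j, star (W i s) * Φ (Matrix.single s t 1) i j * W j t =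
      Φ (Matrix.single s t 1) s t := fun s t => by
    have h1 : W.conjTranspose * Φ (Matrix.single s t 1) * W = Φ (Matrix.single s t 1) := by
      rw [mul_assoc, (h _).eq, ← mul_assoc, ← Matrix.star_eq_conjTranspose,
        Matrix.mem_unitaryGroup_iff'.mp hW, one_mul]
    conv_rhs => rw [← h1]
    simp only [Matrix.mul_apply, Finset.sum_mul, Matrix.conjTranspose_apply]
    exact Finset.sum_comm
  rw [trace_eq_sum_single]
  simp only [← hst, dotProduct, Matrix.mulVec, Fintype.sum_prod_type, Finset.mul_sum,
    Finset.sum_div, choiMatrix_apply, choiVec, Pi.star_apply]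
  rw [Finset.sum_comm]
  refine Finset.sum_congr rfl fun s _ => ?_
  rw [Finset.sum_comm_cycle]
  refine Finset.sum_congr rfl fun t _ => Finset.sum_congr rfl fun i _ =>
    Finset.sum_congr rfl fun j _ => ?_
  rw [star_div₀, sq]
  nth_rewrite 3 [← sqrt_card_mul_self]
  have : star (√(Fintype.card κ : ℝ) : ℂ) = (√(Fintype.card κ : ℝ) : ℂ) := by simp
  rw [this]
  ring

end ChoiVector

/-! ### Overlaps and the frame-potential bound -/

section Overlap

variable {ι : Type*} [Fintype ι] [DecidableEq ι]

/-- The normalized overlap `|tr (Vᴴ U)| / d` of two unitaries. -/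
noncomputable def overlap (V U : Matrix.unitaryGroup ι ℂ) : ℝ :=
  ‖((V : Matrix ι ι ℂ).conjTranspose * (U : Matrix ι ι ℂ)).trace / Fintype.card ι‖

theorem overlap_self [Nonempty ι] (U : Matrix.unitaryGroup ι ℂ) : overlap U U = 1 := by
  rw [overlap, ← Matrix.star_eq_conjTranspose, Matrix.mem_unitaryGroup_iff'.mp U.2,
    Matrix.trace_one, div_self (Nat.cast_ne_zero.mpr Fintype.card_ne_zero), norm_one]

/-- Unitaries whose channels are close in diamond distance have a large overlap. -/
theorem one_sub_sq_le_overlap_sq [Nonempty ι] {U V : Matrix.unitaryGroup ι ℂ} {δ : ℝ}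
    (hδ : 0 ≤ δ) (h : diamondNorm (conjChannel (U : Matrix ι ι ℂ) -
      conjChannel (V : Matrix ι ι ℂ)) / 2 ≤ ENNReal.ofReal δ) :
    1 - δ ^ 2 ≤ overlap V U ^ 2 := by
  rw [overlap, ← star_choiVec_dotProduct_choiVec]
  refine one_sub_sq_le_of_traceNorm_sub_le (star_choiVec_dotProduct_self U.2)
    (star_choiVec_dotProduct_self V.2) hδ ?_
  rw [← choiMatrix_conjChannel, ← choiMatrix_conjChannel, ← choiMatrix_sub,
    ← ENNReal.ofReal_le_ofReal_iff hδ, ENNReal.ofReal_div_of_pos two_pos, ENNReal.ofReal_ofNat]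
  exact (ENNReal.div_le_div_right (ofReal_traceNorm_choiMatrix_le _) 2).trans h

theorem norm_trace_tensorPow_sq (k : ℕ) (V U : Matrix.unitaryGroup ι ℂ) :
    ‖((tensorPow k (V : Matrix ι ι ℂ)).conjTranspose * tensorPow k (U : Matrix ι ι ℂ)).trace /
      Fintype.card (Fin k → ι)‖ ^ 2 = (overlap V U ^ 2) ^ k := by
  rw [← tensorPow_conjTranspose, ← tensorPow_mul, trace_tensorPow, overlap, Fintype.card_fun,
    Fintype.card_fin, Nat.cast_pow, ← div_pow, norm_pow, ← pow_mul, ← pow_mul, mul_comm]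

/-- The frame-potential bound: the mean of the `2k`-th power of the overlap of an approximate
`k`-design with a fixed unitary. -/
theorem IsApproxDesign.sum_weight_mul_overlap_le [Nonempty ι] {N k : ℕ} {ε : ℝ} (hε : 0 ≤ ε)
    {E : UnitaryEnsemble ι N} (hE : IsApproxDesign E k ε) (V : Matrix.unitaryGroup ι ℂ) :
    ∑ i, E.weight i * (overlap V (E.unitary i) ^ 2) ^ k ≤
      (k.factorial : ℝ) / (Fintype.card ι : ℝ) ^ (2 * k) * (1 + ε) := by
  have hW := tensorPow_mem_unitaryGroup (k := k) V
  set W := tensorPow k (V : Matrix ι ι ℂ)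
  have h1 : star (choiVec W) ⬝ᵥ (choiMatrix (E.twirl k)).mulVec (choiVec W) =
      ((∑ i, E.weight i * (overlap V (E.unitary i) ^ 2) ^ k : ℝ) : ℂ) := by
    rw [UnitaryEnsemble.twirl, choiMatrix_sum_smul, Matrix.sum_mulVec, dotProduct_sum,
      Complex.ofReal_sum]
    refine Finset.sum_congr rfl fun i _ => ?_
    rw [Matrix.smul_mulVec, dotProduct_smul, choiForm_conjChannel, norm_trace_tensorPow_sq,
      smul_eq_mul, Complex.ofReal_mul]
  have h2 : star (choiVec W) ⬝ᵥ (choiMatrix (haarTwirl ι k)).mulVec (choiVec W) =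
      (((Module.finrank ℂ (unitaryCommutant ι k) : ℝ) /
        (Fintype.card ι : ℝ) ^ (2 * k) : ℝ) : ℂ) := by
    rw [choiForm_of_commute hW fun X => isProj_haarTwirl.map_mem X V, trace_haarTwirl,
      Fintype.card_fun, Fintype.card_fin]
    push_cast
    rw [← pow_mul, mul_comm k]
  -- The diamond norm enters only through this one test vector.
  have h3 := norm_quadraticForm_le_traceNorm (choiMatrix (E.twirl k - haarTwirl ι k))
    (star_choiVec_dotProduct_self hW)
  rw [choiMatrix_sub, Matrix.sub_mulVec, dotProduct_sub, h1, h2, ← Complex.ofReal_sub,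
    Complex.norm_real, ← choiMatrix_sub] at h3
  have h4 := (ENNReal.ofReal_le_ofReal_iff (by positivity)).mp
    ((ofReal_traceNorm_choiMatrix_le _).trans hE)
  have h5 : (Module.finrank ℂ (unitaryCommutant ι k) : ℝ) / (Fintype.card ι : ℝ) ^ (2 * k) ≤
      (k.factorial : ℝ) / (Fintype.card ι : ℝ) ^ (2 * k) := by
    gcongr
    exact finrank_unitaryCommutant_le
  have h6 := (le_abs_self _).trans (h3.trans h4)
  linarith

/-- Markov's inequality for `overlap ^ (2k)`. It serves with `c = 1` for a single unitary and with
`c = 1 - δ²` for a ball around a circuit. -/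
theorem IsApproxDesign.sum_weight_le [Nonempty ι] {N k : ℕ} {ε c : ℝ} (hε : 0 ≤ ε) (hc : 0 < c)
    {E : UnitaryEnsemble ι N} (hE : IsApproxDesign E k ε) (V : Matrix.unitaryGroup ι ℂ)
    {P : Fin N → Prop} [DecidablePred P] (hP : ∀ i, P i → c ≤ overlap V (E.unitary i) ^ 2) :
    ∑ i, (if P i then E.weight i else 0) ≤
      (k.factorial : ℝ) / (Fintype.card ι : ℝ) ^ (2 * k) * (1 + ε) / c ^ k := by
  rw [le_div_iff₀ (by positivity), Finset.sum_mul]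
  refine le_trans (Finset.sum_le_sum fun i _ => ?_) (hE.sum_weight_mul_overlap_le hε V)
  split_ifs with h
  · have := hP i h
    have := E.weight_nonneg i
    gcongr
  · rw [zero_mul]
    exact mul_nonneg (E.weight_nonneg i) (by positivity)

end Overlap

/-! ### Counting circuits -/

section Circuits

variable {n q : ℕ} (periodic : Bool) (G : Finset (Matrix.unitaryGroup (Fin q × Fin q) ℂ))

theorem IsNeighbourPair.right_unique {periodic : Bool} {i j j' : Fin n}
    (h : IsNeighbourPair periodic i j) (h' : IsNeighbourPair periodic i j') : j = j' := by
  have := j.2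
  have := j'.2
  unfold IsNeighbourPair at h h'
  ext
  omega

/-- The first qudit of a neighbouring pair determines the second, so `n |G|` parameters suffice.
Parameters without a neighbour get the dummy value 1. -/
theorem exists_localGates_subset_range :
    ∃ f : Fin n × G → Matrix.unitaryGroup (Fin n → Fin q) ℂ,
      localGates periodic G ⊆ Set.range f := by
  classical
  refine ⟨fun x => if h : ∃ j, x.1 ≠ j ∧ IsNeighbourPair periodic x.1 j then
    gate x.1 h.choose h.choose_spec.1 x.2 else 1, ?_⟩
  rintro W ⟨g, hg, i, j, hij, hn, rfl⟩
  have h : ∃ j, i ≠ j ∧ IsNeighbourPair periodic i j := ⟨j, hij, hn⟩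
  refine ⟨(i, ⟨g, hg⟩), ?_⟩
  simp only [dif_pos h]
  congr 1
  exact h.choose_spec.2.right_unique hn

theorem one_mem_localGates (hn : 2 ≤ n) (hG : 1 ∈ G) :
    (1 : Matrix.unitaryGroup (Fin n → Fin q) ℂ) ∈ localGates periodic G :=
  ⟨1, hG, ⟨0, by omega⟩, ⟨1, by omega⟩, by simp, Or.inl rfl,
    Subtype.ext (gateMatrix_one _ _).symm⟩

/-- Padding with identity gates makes every circuit have length exactly `r`, so shorter ones cost no
extra terms in the count. -/
theorem exists_finset_circuits_subset (hn : 1 ≤ n) (hG : 1 ∈ G) (r : ℕ) :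
    ∃ C : Finset (Matrix.unitaryGroup (Fin n → Fin q) ℂ),
      circuits periodic G r ⊆ (C : Set (Matrix.unitaryGroup (Fin n → Fin q) ℂ)) ∧
        C.card ≤ (n * G.card) ^ r := by
  classical
  -- A single qudit has no pair to carry the padding gates, but then only the empty circuit exists.
  rcases hn.eq_or_lt with rfl | hn
  · refine ⟨{1}, ?_, ?_⟩
    · rintro V ⟨L, -, hL, rfl⟩
      have : L = [] := List.eq_nil_iff_forall_not_mem.mpr fun W hW => by
        obtain ⟨_, _, i, j, hij, _⟩ := hL W hW
        exact hij (Subsingleton.elim i j)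
      simp [this]
    · rw [Finset.card_singleton]
      exact Nat.one_le_pow _ _ (by rw [one_mul]; exact Finset.card_pos.mpr ⟨1, hG⟩)
  · obtain ⟨f, hf⟩ := exists_localGates_subset_range (n := n) periodic G
    refine ⟨Finset.univ.image fun x : Fin r → Fin n × G => (List.ofFn fun l => f (x l)).prod,
      ?_, ?_⟩
    · rintro V ⟨L, hLr, hL, rfl⟩
      have hmem : ∀ W ∈ L ++ List.replicate (r - L.length) 1, W ∈ localGates periodic G := by
        intro W hW
        rcases List.mem_append.mp hW with h | h
        · exact hL W h
        · rw [List.eq_of_mem_replicate h]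
          exact one_mem_localGates periodic G hn hG
      have hlen : (L ++ List.replicate (r - L.length) 1).length = r := by simp; omega
      have hprod : (L ++ List.replicate (r - L.length) 1).prod = L.prod := by simp
      rw [← hprod]
      generalize L ++ List.replicate (r - L.length) 1 = M at hmem hlen
      subst hlen
      choose x hx using fun l : Fin M.length => hf (hmem (M.get l) (List.get_mem M l))
      simp only [Finset.coe_image, Finset.coe_univ, Set.image_univ, Set.mem_range]
      exact ⟨x, by simp only [hx, List.ofFn_get]⟩
    · refine Finset.card_image_le.trans ?_
      simp

end Circuits

end QComplexity

/-! ### The covering argument -/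

theorem mainTheorem9 (n q : ℕ) (hn : 1 ≤ n) (hq : 1 ≤ q) (periodic : Bool)
    (G : Finset (Matrix.unitaryGroup (Fin q × Fin q) ℂ)) (hG : 1 ∈ G)
    (k r N : ℕ) (ε δ : ℝ) (hε : 0 ≤ ε) (hδ₀ : 0 ≤ δ) (hδ₁ : δ < 1)
    (E : QComplexity.UnitaryEnsemble (Fin n → Fin q) N)
    (hE : QComplexity.IsApproxDesign E k ε) :
    ((q : ℝ) ^ n) ^ (2 * k) / (k.factorial : ℝ) * (1 / (1 + ε)) -
        (n : ℝ) ^ r * (G.card : ℝ) ^ r / (1 - δ ^ 2) ^ k ≤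
      (({U : Matrix.unitaryGroup (Fin n → Fin q) ℂ |
          (∃ i, 0 < E.weight i ∧ E.unitary i = U) ∧
            (r : ℕ∞) < QComplexity.weakUnitaryComplexity periodic G δ U}.ncard : ℕ) : ℝ) := by
  open QComplexity in
  classical
  have : Nonempty (Fin q) := ⟨⟨0, hq⟩⟩
  set S := {U : Matrix.unitaryGroup (Fin n → Fin q) ℂ |
    (∃ i, 0 < E.weight i ∧ E.unitary i = U) ∧
      (r : ℕ∞) < weakUnitaryComplexity periodic G δ U} with hS
  have hSfin : S.Finite := (Set.finite_range E.unitary).subset fun U hU =>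
    let ⟨i, _, hi⟩ := hU.1
    ⟨i, hi⟩
  obtain ⟨C, hC, hCcard⟩ := exists_finset_circuits_subset (q := q) periodic G hn hG r
  have hd : ((Fintype.card (Fin n → Fin q) : ℕ) : ℝ) = (q : ℝ) ^ n := by simp
  have hq0 : (0 : ℝ) < q := by exact_mod_cast hq
  set B : ℝ := (k.factorial : ℝ) / ((q : ℝ) ^ n) ^ (2 * k) * (1 + ε) with hB
  have hBpos : 0 < B := by positivity
  have hc : 0 < 1 - δ ^ 2 := by nlinarith
  -- Each index of positive weight is charged to a complex unitary or to a nearby circuit. Summing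
  -- over `U` rather than over indices counts repeated unitaries once.
  have hcover : ∀ i, E.weight i ≤ (∑ U ∈ hSfin.toFinset, if E.unitary i = U then E.weight i else 0) +
      ∑ V ∈ C, if 1 - δ ^ 2 ≤ overlap V (E.unitary i) ^ 2 then E.weight i else 0 := fun i => by
    have hw := E.weight_nonneg i
    have h1 : 0 ≤ ∑ U ∈ hSfin.toFinset, if E.unitary i = U then E.weight i else 0 :=
      Finset.sum_nonneg fun U _ => by split_ifs <;> simp [hw]
    have h2 : 0 ≤ ∑ V ∈ C,
        if 1 - δ ^ 2 ≤ overlap V (E.unitary i) ^ 2 then E.weight i else 0 :=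
      Finset.sum_nonneg fun V _ => by split_ifs <;> simp [hw]
    rcases hw.eq_or_lt with h0 | hpos
    · linarith
    by_cases hi : E.unitary i ∈ S
    · have : E.weight i ≤ ∑ U ∈ hSfin.toFinset, if E.unitary i = U then E.weight i else 0 := by
        rw [Finset.sum_ite_eq, if_pos (hSfin.mem_toFinset.mpr hi)]
      linarith
    · have hle : weakUnitaryComplexity periodic G δ (E.unitary i) ≤ (r : ℕ∞) :=
        not_lt.mp fun h => hi ⟨⟨i, hpos, rfl⟩, h⟩
      obtain ⟨V, hV, hVd⟩ := (weakUnitaryComplexity_le_iff periodic G δ _ r).mp hle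
      have : E.weight i ≤ ∑ V ∈ C,
          if 1 - δ ^ 2 ≤ overlap V (E.unitary i) ^ 2 then E.weight i else 0 := by
        refine le_trans ?_ (Finset.single_le_sum (fun V _ => by split_ifs <;> simp [hw]) (hC hV))
        rw [if_pos (one_sub_sq_le_overlap_sq hδ₀ hVd)]
      linarith
  have hsumS : ∀ U, ∑ i, (if E.unitary i = U then E.weight i else 0) ≤ B := fun U => by
    have h := hE.sum_weight_le hε one_pos U (P := fun i => E.unitary i = U)
      (fun i hi => by rw [hi, overlap_self, one_pow])
    rwa [one_pow, div_one, hd] at h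
  have hsumC : ∀ V, ∑ i, (if 1 - δ ^ 2 ≤ overlap V (E.unitary i) ^ 2 then E.weight i else 0) ≤
      B / (1 - δ ^ 2) ^ k := fun V => by
    have h := hE.sum_weight_le hε hc V fun i hi => hi
    rwa [hd] at h
  have htotal : 1 ≤ (S.ncard : ℝ) * B + C.card * (B / (1 - δ ^ 2) ^ k) := by
    calc (1 : ℝ) = ∑ i, E.weight i := E.weight_sum.symm
      _ ≤ _ := Finset.sum_le_sum fun i _ => hcover i
      _ ≤ _ := by
        rw [Finset.sum_add_distrib, Finset.sum_comm, Finset.sum_comm (t := C),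
          Set.ncard_eq_toFinset_card S hSfin, ← nsmul_eq_mul, ← nsmul_eq_mul]
        exact add_le_add (Finset.sum_le_card_nsmul _ _ _ fun U _ => hsumS U)
          (Finset.sum_le_card_nsmul _ _ _ fun V _ => hsumC V)
  have hCle : (C.card : ℝ) ≤ (n : ℝ) ^ r * (G.card : ℝ) ^ r := by
    rw [← mul_pow]
    exact_mod_cast hCcard
  -- The main term is exactly `1 / B`, so the claim is `htotal` divided by `B`, with `hCle`
  -- inserted.
  have hinv : ((q : ℝ) ^ n) ^ (2 * k) / (k.factorial : ℝ) * (1 / (1 + ε)) = 1 / B := by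
    rw [hB]
    field_simp
  rw [hinv, sub_le_iff_le_add, div_le_iff₀ hBpos]
  calc (1 : ℝ) ≤ _ := htotal
    _ = ((S.ncard : ℝ) + C.card / (1 - δ ^ 2) ^ k) * B := by ring
    _ ≤ _ := by gcongr
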